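/- Let $G$ be a finite simple graph of order $n \ge 7$. Suppose that $G$ is $2$-connected (that is, $G$ is connected and remains connected after the deletion of any one vertex) and that $G$ is a $[4,2]$-graph (that is, every induced subgraph of $G$ on $4$ vertices has at least $2$ edges). Then $G$ is pancyclic: for every integer $k$ with $3 \le k \le n$, $G$ contains a cycle of length $k$. -/

import Mathlib

namespace SimpleGraph

variable {V : Type*}

/-- `G` is an `[s,t]`-graph: every induced subgraph of order `s` has size at least `t`. -/
def IsSTGraph [Finite V] (G : SimpleGraph V) (s t : ℕ) : Prop :=
  ∀ S : Finset V, S.card = s → t ≤ (G.induce (S : Set V)).edgeSet.ncard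

/-- `G` is `k`-connected: it has more than `k` vertices, and deleting any set of fewer than `k`
vertices leaves a connected graph. -/
def IsKVertexConnected [Finite V] (G : SimpleGraph V) (k : ℕ) : Prop :=
  k < Nat.card V ∧ ∀ S : Finset V, S.card < k → (G.induce ((S : Set V)ᶜ)).Connected

/-- `G` contains a `k`-cycle, that is, a cycle of length `k`. -/
def HasCycleOfLength (G : SimpleGraph V) (k : ℕ) : Prop :=
  ∃ (v : V) (c : G.Walk v v), c.IsCycle ∧ c.length = k

/-- `G` is pancyclic: it contains a `k`-cycle for every `k` from `3` to its order. -/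
def IsPancyclic [Finite V] (G : SimpleGraph V) : Prop :=
  ∀ k : ℕ, 3 ≤ k → k ≤ Nat.card V → G.HasCycleOfLength k

end SimpleGraph

/-! A triangle exists, and any cycle `C` that misses a vertex can be replaced by a cycle one longer.
The local tool is `IsSTGraph.exists_adj`: four vertices never span just one edge, so enough known
non-edges force a new edge.

If an outside vertex has two neighbours on `C`, reroute `C` through it; when every rerouting is
blocked, the blocked chords are non-edges that force further chords or a contradiction
(`hasCycleList_of_adj_adj`). Length 4 needs its own argument
(`IsSTGraph.hasCycleList_five_of_adj_opposite`).

Otherwise each outside vertex has at most one neighbour on `C`. A triangle is treated separately;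
for longer `C` the outside is a clique, 2-connectedness gives two disjoint edges leaving `C`, and
`C` without their ends is a clique too. A cycle through both edges can then be cut to the required
length (`hasCycleList_succ_of_isClique`). -/

namespace SimpleGraph

variable {V : Type*} {G : SimpleGraph V}

/-- The vertices `a :: l` are distinct and form, in this order, a closed walk of `G`. -/
def IsCycleList (G : SimpleGraph V) (a : V) (l : List V) : Prop :=
  (a :: l).Nodup ∧ (a :: (l ++ [a])).IsChain G.Adj

/-- `k` vertices of `G` can be arranged into a cycle list. -/
def HasCycleList (G : SimpleGraph V) (k : ℕ) : Prop :=
  ∃ a l, G.IsCycleList a l ∧ (a :: l).length = k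

/-- The bound on `k` matters: two adjacent vertices also form a cycle list. -/
theorem HasCycleList.hasCycleOfLength {k : ℕ} (hk : 3 ≤ k) (h : G.HasCycleList k) :
    G.HasCycleOfLength k := by
  obtain ⟨a, l, ⟨hnd, hch⟩, hlen⟩ := h
  obtain ⟨p, hs⟩ : ∃ p : G.Walk a a, p.support = a :: (l ++ [a]) := by
    have hne : a :: (l ++ [a]) ≠ [] := by simp
    exact ⟨(Walk.ofSupport _ hne hch).copy (by simp) (by simp),
      (Walk.support_copy ..).trans (Walk.support_ofSupport hne hch)⟩
  have hl : p.length = k := by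
    have := p.length_support
    rw [hs] at this
    simp only [List.length_cons, List.length_append, List.length_nil] at this hlen
    omega
  refine ⟨a, p, ?_, hl⟩
  rw [Walk.isCycle_iff_isPath_tail_and_le_length, hl]
  refine ⟨?_, hk⟩
  have hnn : ¬ p.Nil := by
    rw [← Walk.length_eq_zero_iff, hl]; omega
  rw [Walk.isPath_def, Walk.support_tail_of_not_nil _ hnn, hs, List.tail_cons,
    List.nodup_append_comm]
  exact hnd

/-- At most one of the two guaranteed edges is `ab`. -/
theorem IsSTGraph.exists_adj [Finite V] (hst : G.IsSTGraph 4 2) {a b c d : V}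
    (hab : a ≠ b) (hac : a ≠ c) (had : a ≠ d) (hbc : b ≠ c) (hbd : b ≠ d) (hcd : c ≠ d) :
    G.Adj a c ∨ G.Adj a d ∨ G.Adj b c ∨ G.Adj b d ∨ G.Adj c d := by
  classical
  by_contra! hcon
  obtain ⟨h1, h2, h3, h4, h5⟩ := hcon
  have hS := hst {a, b, c, d} (by
    rw [Finset.card_eq_of_equiv_fin]
    exact (Finset.equivFinOfCardEq (by simp [*])))
  have ha : a ∈ (({a, b, c, d} : Finset V) : Set V) := by simp
  have hb : b ∈ (({a, b, c, d} : Finset V) : Set V) := by simp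
  have hsub : (G.induce (({a, b, c, d} : Finset V) : Set V)).edgeSet ⊆ {s(⟨a, ha⟩, ⟨b, hb⟩)} := by
    intro e
    induction e with
    | _ x y =>
      obtain ⟨x, hx⟩ := x
      obtain ⟨y, hy⟩ := y
      simp only [mem_edgeSet, comap_adj, Function.Embedding.subtype_apply, Set.mem_singleton_iff,
        Sym2.eq_iff, Subtype.mk.injEq]
      simp only [Finset.coe_insert, Finset.coe_singleton, Set.mem_insert_iff,
        Set.mem_singleton_iff] at hx hy
      intro hadj
      have hsymm := hadj.symm
      have hneq := hadj.ne
      rcases hx with rfl | rfl | rfl | rfl <;> rcases hy with rfl | rfl | rfl | rfl <;> simp_all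
  have := Set.ncard_le_ncard hsub (Set.finite_singleton _)
  rw [Set.ncard_singleton] at this
  omega

theorem exists_adj_of_connected_induce_compl {S : Finset V}
    (h : (G.induce ((S : Set V)ᶜ)).Connected) (T : Set V) {x y : V} (hx : x ∈ T) (hxS : x ∉ S)
    (hy : y ∉ T) (hyS : y ∉ S) :
    ∃ u v, G.Adj u v ∧ u ∈ T ∧ u ∉ S ∧ v ∉ T ∧ v ∉ S := by
  obtain ⟨p⟩ := h.preconnected ⟨x, by simpa using hxS⟩ ⟨y, by simpa using hyS⟩
  obtain ⟨d, -, h1, h2⟩ := p.exists_boundary_dart (Subtype.val ⁻¹' T) hx hy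
  exact ⟨_, _, d.adj, h1, d.fst.2, h2, d.snd.2⟩

/-! ### Rotating and rearranging cycle lists -/

theorem IsCycleList.rotate {a u : V} {A B : List V} (h : G.IsCycleList a (A ++ u :: B)) :
    G.IsCycleList u (B ++ a :: A) := by
  obtain ⟨h1, h2⟩ := h
  constructor
  · have : (u :: (B ++ a :: A)).Perm (a :: (A ++ u :: B)) := by
      have := List.perm_append_comm (l₁ := u :: B) (l₂ := a :: A)
      simpa using this
    exact this.nodup_iff.mpr h1
  · have e1 : a :: (A ++ u :: B ++ [a]) = (a :: A) ++ u :: (B ++ [a]) := by simp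
    have e2 : u :: (B ++ a :: A ++ [u]) = (u :: B) ++ a :: (A ++ [u]) := by simp
    rw [e1, List.isChain_split] at h2
    rw [e2, List.isChain_split]
    exact ⟨by simpa using h2.2, by simpa using h2.1⟩

/-- Every cycle list can be rotated to start at any of its vertices. -/
theorem IsCycleList.exists_rotate {a u : V} {l : List V} (h : G.IsCycleList a l)
    (hu : u ∈ a :: l) : ∃ m, G.IsCycleList u m ∧ (u :: m).Perm (a :: l) := by
  rcases List.mem_cons.mp hu with rfl | hu
  · exact ⟨l, h, .refl _⟩
  · obtain ⟨A, B, rfl⟩ := List.append_of_mem hu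
    refine ⟨_, h.rotate, ?_⟩
    simpa using List.perm_append_comm (l₁ := u :: B) (l₂ := a :: A)

theorem HasCycleList.of_perm {C : List V} {h b : V} {m : List V} (hC : C.Nodup) (hh : h ∉ C)
    (hp : (b :: m).Perm (h :: C)) (hch : (b :: (m ++ [b])).IsChain G.Adj) :
    G.HasCycleList (C.length + 1) :=
  ⟨b, m, ⟨hp.nodup_iff.mpr (List.nodup_cons.mpr ⟨hh, hC⟩), hch⟩, by rw [hp.length_eq]; rfl⟩

/-! ### An outside vertex with two neighbours on the cycle -/

theorem isChain_reverse_adj {l : List V} : l.reverse.IsChain G.Adj ↔ l.IsChain G.Adj := by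
  rw [List.isChain_reverse]
  simp only [G.adj_comm]

/-- Write the cycle as `x P u Q`, where `u` is the first neighbour of `h` after `x`, so `h` has no
neighbour in `P`. If no rerouting through `h` works, the successors of `x` and `u` are non-adjacent,
so are their predecessors, and `h` avoids both ends of `Q`. Length 4 is the case where `P` and `Q`
are single vertices, out of reach of the quadruples used here. -/
theorem hasCycleList_of_adj_adj [Finite V] (hst : G.IsSTGraph 4 2) {a h : V} {l : List V}
    (hC : G.IsCycleList a l) (hlen : (a :: l).length ≠ 4) (hh : h ∉ a :: l) {x y : V}
    (hx : x ∈ a :: l) (hy : y ∈ a :: l) (hxy : x ≠ y) (hhx : G.Adj h x) (hhy : G.Adj h y) :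
    G.HasCycleList ((a :: l).length + 1) := by
  classical
  obtain ⟨m, hm, hperm⟩ := hC.exists_rotate hx
  rw [← hperm.length_eq] at hlen ⊢
  rw [← hperm.mem_iff] at hh hy
  clear hperm hC hx
  have hym : y ∈ m := by simpa [hxy.symm] using hy
  clear hy
  obtain ⟨P, u, Q, rfl, hhu, hP⟩ : ∃ P u Q, m = P ++ u :: Q ∧ G.Adj h u ∧ ∀ z ∈ P, ¬ G.Adj h z := by
    obtain ⟨u, hu⟩ := Option.isSome_iff_exists.mp
      (List.find?_isSome (xs := m) (p := fun z => decide (G.Adj h z)) |>.mpr ⟨y, hym, by simpa⟩)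
    obtain ⟨h1, P, Q, h2, h3⟩ := List.find?_eq_some_iff_append.mp hu
    exact ⟨P, u, Q, h2, by simpa using h1, by simpa using h3⟩
  clear hym hxy hhy
  obtain ⟨hnd, hch⟩ := hm
  have e1 : x :: (P ++ u :: Q ++ [x]) = (x :: P) ++ u :: (Q ++ [x]) := by simp
  rw [e1, List.isChain_split] at hch
  obtain ⟨hPc, hQc⟩ := hch
  by_contra hno
  -- any rearrangement of the cycle together with `h` is not a cycle
  have key : ∀ b m', (b :: m').Perm (h :: x :: (P ++ u :: Q)) →
      ¬ (b :: (m' ++ [b])).IsChain G.Adj := fun b m' hp hc => hno (.of_perm hnd hh hp hc)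
  clear hno
  have hhu' := hhu.symm
  have hhx' := hhx.symm
  -- The chord `pq` would give `x`, `h`, `u`, back along `P` to `p`, then `q` and on along `Q`; `A2`
  -- is the mirror image.
  have A1 : ∀ p P' q Q', P = p :: P' → Q = q :: Q' → ¬ G.Adj p q := by
    rintro p P' q Q' rfl rfl hpq
    refine key x (h :: (u :: P'.reverse ++ [p]) ++ q :: Q') ?_ ?_
    · simp only [List.perm_iff_count, List.count_cons, List.count_append, List.count_reverse,
        List.count_nil]
      intro z; ring
    · have e : x :: (h :: (u :: P'.reverse ++ [p]) ++ q :: Q' ++ [x]) =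
        (x :: h :: u :: P'.reverse) ++ p :: q :: (Q' ++ [x]) := by simp
      have e2 : (x :: h :: u :: P'.reverse) ++ [p] = x :: h :: (p :: (P' ++ [u])).reverse := by simp
      have e3 : (p :: (P' ++ [u])).reverse = u :: (P'.reverse ++ [p]) := by simp
      rw [e, List.isChain_append_cons_cons, e2, e3, List.isChain_cons_cons, List.isChain_cons_cons,
        ← e3, isChain_reverse_adj]
      exact ⟨⟨hhx', hhu, hPc.of_cons⟩, hpq, hQc.of_cons⟩
  have A2 : ∀ P' w Q' z, P = P' ++ [w] → Q = Q' ++ [z] → ¬ G.Adj w z := by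
    rintro P' w Q' z rfl rfl hwz
    refine key x (P' ++ w :: z :: Q'.reverse ++ [u, h]) ?_ ?_
    · simp only [List.perm_iff_count, List.count_cons, List.count_append, List.count_reverse,
        List.count_nil]
      intro z; ring
    · have e : x :: (P' ++ w :: z :: Q'.reverse ++ [u, h] ++ [x]) =
        (x :: P') ++ w :: z :: (Q'.reverse ++ u :: h :: [x]) := by simp
      have e3 : z :: Q'.reverse ++ [u] = (u :: (Q' ++ [z])).reverse := by simp
      rw [e, List.isChain_append_cons_cons, ← List.cons_append, List.isChain_append_cons_cons, e3,
        isChain_reverse_adj]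
      have e4 : x :: (P' ++ [w]) ++ [u] = (x :: P') ++ w :: u :: [] := by simp
      have e5 : u :: (Q' ++ [z] ++ [x]) = (u :: Q') ++ z :: x :: [] := by simp
      rw [e4, List.isChain_append_cons_cons] at hPc
      rw [e5, List.isChain_append_cons_cons] at hQc
      exact ⟨hPc.1, hwz, hQc.1, hhu', by simpa using hhx⟩
  have B1 : ∀ q Q', Q = q :: Q' → ¬ G.Adj h q := by
    rintro q Q' rfl hhq
    refine key x (P ++ u :: h :: q :: Q') ?_ ?_
    · simp only [List.perm_iff_count, List.count_cons, List.count_append]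
      intro z; ring
    · have e : x :: (P ++ u :: h :: q :: Q' ++ [x]) = (x :: P) ++ u :: h :: q :: (Q' ++ [x]) := by
        simp
      rw [e, List.isChain_append_cons_cons, List.isChain_cons_cons]
      exact ⟨hPc, hhu', hhq, hQc.of_cons⟩
  have B2 : ∀ Q' z, Q = Q' ++ [z] → ¬ G.Adj h z := by
    rintro Q' z rfl hhz
    refine key x (P ++ u :: Q' ++ [z, h]) ?_ ?_
    · simp only [List.perm_iff_count, List.count_cons, List.count_append, List.count_nil]
      intro z; ring
    · have e : x :: (P ++ u :: Q' ++ [z, h] ++ [x]) = (x :: P) ++ u :: (Q' ++ z :: h :: [x]) := by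
        simp
      have e5 : u :: (Q' ++ [z] ++ [x]) = (u :: Q') ++ z :: x :: [] := by simp
      rw [e5, List.isChain_append_cons_cons] at hQc
      rw [e, List.isChain_split, ← List.cons_append, List.isChain_append_cons_cons]
      exact ⟨hPc, hQc.1, hhz.symm, by simpa using hhx⟩
  rcases P with _ | ⟨p, P⟩
  · refine key x (h :: u :: Q) ?_ ?_
    · exact List.Perm.swap ..
    · exact .cons_cons hhx' (.cons_cons hhu hQc)
  rcases eq_or_ne Q [] with rfl | hQ
  · refine key x (p :: P ++ [u, h]) ?_ ?_
    · simp only [List.perm_iff_count, List.count_cons, List.count_append, List.count_nil]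
      intro z; ring
    · have : x :: (p :: P ++ [u, h] ++ [x]) = (x :: p :: P) ++ u :: [h, x] := by simp
      rw [this, List.isChain_split]
      exact ⟨hPc, by simp [hhx, hhu']⟩
  obtain ⟨q, Q, rfl⟩ := List.exists_cons_of_ne_nil hQ
  clear hQ
  have hpq := A1 _ _ _ _ rfl rfl
  have hhq := B1 _ _ rfl
  have hhp := hP p (by simp)
  rcases P.eq_nil_or_concat' with rfl | ⟨P', w, rfl⟩ <;>
    rcases Q.eq_nil_or_concat' with rfl | ⟨Q', z, rfl⟩
  · simp at hlen
  · have hpz := A2 [] p (q :: Q') z rfl rfl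
    have hhz := B2 (q :: Q') z rfl
    -- These four vertices span at most the edge `qz`.
    have := hst.exists_adj (a := q) (b := z) (c := p) (d := h)
    simp only [List.nodup_cons, List.mem_cons, List.mem_append, List.nodup_append] at hnd hh
    grind [G.adj_comm]
  · have hwq := A2 (p :: P') w [] q rfl rfl
    have hhw := hP w (by simp)
    have := hst.exists_adj (a := p) (b := w) (c := q) (d := h)
    simp only [List.nodup_cons, List.mem_cons, List.mem_append, List.nodup_append] at hnd hh
    grind [G.adj_comm]
  · have hhz := B2 (q :: Q') z rfl
    obtain ⟨r, R, hR⟩ := List.exists_cons_of_ne_nil (l := P' ++ [w]) (by simp)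
    rw [hR] at hP hh hnd hPc key
    have hhr := hP r (by simp)
    have T1 := hst.exists_adj (a := p) (b := r) (c := h) (d := q)
    have T2 := hst.exists_adj (a := q) (b := z) (c := h) (d := p)
    simp only [List.nodup_cons, List.mem_cons, List.mem_append, List.nodup_append] at hnd hh
    -- In each of the quadruples `T1` and `T2` all other candidates are excluded, which forces the
    -- chords `rq` and `zp`. They allow `p` to move between `z` and `x`, while `h` enters between
    -- `x` and `u`.
    have hrq : G.Adj r q := by grind [G.adj_comm]
    have hzp : G.Adj z p := by grind [G.adj_comm]
    refine key x (h :: u :: R.reverse ++ r :: q :: Q' ++ [z, p]) ?_ ?_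
    · simp only [List.perm_iff_count, List.count_cons, List.count_append, List.count_nil,
        List.count_reverse]
      intro z; ring
    · have e : x :: (h :: u :: R.reverse ++ r :: q :: Q' ++ [z, p] ++ [x]) =
        (x :: h :: u :: R.reverse) ++ r :: q :: (Q' ++ z :: p :: [x]) := by simp
      have e2 : (x :: h :: u :: R.reverse) ++ [r] = x :: h :: (r :: (R ++ [u])).reverse := by simp
      have e3 : (r :: (R ++ [u])).reverse = u :: (R.reverse ++ [r]) := by simp
      have e5 : u :: (q :: (Q' ++ [z]) ++ [x]) = (u :: q :: Q') ++ z :: x :: [] := by simp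
      rw [e5, List.isChain_append_cons_cons] at hQc
      rw [e, List.isChain_append_cons_cons, e2, e3, List.isChain_cons_cons, List.isChain_cons_cons,
        ← e3, isChain_reverse_adj, ← List.cons_append (a := q), List.isChain_append_cons_cons]
      exact ⟨⟨hhx', hhu, hPc.of_cons.of_cons⟩, hrq, hQc.1.of_cons, hzp,
        by simpa using hPc.rel.symm⟩

/-! ### Cycles of length three, four and five -/

theorem exists_notMem_of_length_lt_card [Finite V] (l : List V) (h : l.length < Nat.card V) :
    ∃ z, z ∉ l := by
  classical
  have := Fintype.ofFinite V
  rw [Nat.card_eq_fintype_card] at h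
  obtain ⟨z, -, hz⟩ := Finset.exists_mem_notMem_of_card_lt_card (s := l.toFinset)
    (t := Finset.univ) ((List.toFinset_card_le l).trans_lt h)
  exact ⟨z, by simpa using hz⟩

theorem hasCycleList_three {a b c : V} (hab : G.Adj a b) (hbc : G.Adj b c) (hca : G.Adj c a) :
    G.HasCycleList 3 :=
  ⟨a, [b, c], ⟨by simp [hab.ne, hbc.ne, hca.ne'], by simp [*]⟩, rfl⟩

theorem hasCycleList_four {a b c d : V} (hab : G.Adj a b) (hbc : G.Adj b c) (hcd : G.Adj c d)
    (hda : G.Adj d a) (hac : a ≠ c) (hbd : b ≠ d) : G.HasCycleList 4 :=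
  ⟨a, [b, c, d], ⟨by simp [hab.ne, hbc.ne, hcd.ne, hda.ne', *], by simp [*]⟩, rfl⟩

theorem hasCycleList_five {a b c d e : V} (hab : G.Adj a b) (hbc : G.Adj b c) (hcd : G.Adj c d)
    (hde : G.Adj d e) (hea : G.Adj e a) (h : [a, b, c, d, e].Nodup) : G.HasCycleList 5 :=
  ⟨a, [b, c, d, e], ⟨h, by simp [*]⟩, rfl⟩

/-- Among six vertices there is a triangle or an independent triple. -/
theorem exists_independent_triple (htri : ∀ a b c, G.Adj a b → G.Adj b c → ¬ G.Adj c a)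
    {v a b c d e : V} (hnd : [v, a, b, c, d, e].Nodup) :
    ∃ x y z, x ≠ y ∧ y ≠ z ∧ z ≠ x ∧ ¬ G.Adj x y ∧ ¬ G.Adj y z ∧ ¬ G.Adj z x := by
  by_contra! hind
  -- Any three other vertices include a neighbour and a non-neighbour of `v`; five vertices cannot
  -- be split this way, by pigeonhole.
  have key : ∀ x y z, x ≠ y → y ≠ z → z ≠ x → x ≠ v → y ≠ v → z ≠ v →
      ¬ (G.Adj v x ∧ G.Adj v y ∧ G.Adj v z) ∧ (G.Adj v x ∨ G.Adj v y ∨ G.Adj v z) := by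
    intro x y z
    have h1 := hind x y z
    have h2 := htri v x y
    have h3 := htri v y z
    have h4 := htri v z x
    have h5 := hind v x y
    have h6 := hind v y z
    have h7 := hind v z x
    have h8 := htri x y z
    grind [G.adj_comm]
  simp only [List.nodup_cons, List.mem_cons, List.not_mem_nil, not_or, or_false] at hnd
  have k1 := key a b c
  have k2 := key a b d
  have k3 := key a b e
  have k4 := key a c d
  have k5 := key a c e
  have k6 := key a d e
  have k7 := key b c d
  have k8 := key b c e
  have k9 := key b d e
  have k10 := key c d e
  clear key hind htri
  grind

/-- In a triangle-free graph take an independent triple. Every other vertex is adjacent to at least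
two of its members, so any two others share a neighbour and are non-adjacent. Four of them then span
no edge. -/
theorem IsSTGraph.hasCycleList_three [Finite V] (hst : G.IsSTGraph 4 2) (hn : 7 ≤ Nat.card V) :
    G.HasCycleList 3 := by
  by_contra hno
  have htri : ∀ a b c, G.Adj a b → G.Adj b c → ¬ G.Adj c a :=
    fun a b c h1 h2 h3 => hno (SimpleGraph.hasCycleList_three h1 h2 h3)
  obtain ⟨x, y, z, hxy, hyz, hzx, nxy, nyz, nzx⟩ : ∃ x y z, x ≠ y ∧ y ≠ z ∧ z ≠ x ∧
      ¬ G.Adj x y ∧ ¬ G.Adj y z ∧ ¬ G.Adj z x := by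
    obtain ⟨e, he⟩ := exists_notMem_of_length_lt_card ([] : List V) (by simp; omega)
    obtain ⟨d, hd⟩ := exists_notMem_of_length_lt_card [e] (by simp; omega)
    obtain ⟨c, hc⟩ := exists_notMem_of_length_lt_card [d, e] (by simp; omega)
    obtain ⟨b, hb⟩ := exists_notMem_of_length_lt_card [c, d, e] (by simp; omega)
    obtain ⟨a, ha⟩ := exists_notMem_of_length_lt_card [b, c, d, e] (by simp; omega)
    obtain ⟨v, hv⟩ := exists_notMem_of_length_lt_card [a, b, c, d, e] (by simp; omega)
    exact exists_independent_triple htri (v := v) (a := a) (b := b) (c := c) (d := d) (e := e)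
      (by simp_all)
  obtain ⟨d, hd⟩ := exists_notMem_of_length_lt_card [x, y, z] (by simp; omega)
  obtain ⟨c, hc⟩ := exists_notMem_of_length_lt_card [d, x, y, z] (by simp; omega)
  obtain ⟨b, hb⟩ := exists_notMem_of_length_lt_card [c, d, x, y, z] (by simp; omega)
  obtain ⟨a, ha⟩ := exists_notMem_of_length_lt_card [b, c, d, x, y, z] (by simp; omega)
  have two : ∀ w, w ∉ [x, y, z] →
      (G.Adj w x ∨ G.Adj w y) ∧ (G.Adj w y ∨ G.Adj w z) ∧ (G.Adj w z ∨ G.Adj w x) := by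
    intro w hw
    have h1 := hst.exists_adj (a := x) (b := w) (c := y) (d := z)
    have h2 := hst.exists_adj (a := y) (b := w) (c := z) (d := x)
    have h3 := hst.exists_adj (a := z) (b := w) (c := x) (d := y)
    simp only [List.mem_cons, List.not_mem_nil, or_false, not_or] at hw
    grind [G.adj_comm]
  have non : ∀ v w, v ∉ [x, y, z] → w ∉ [x, y, z] → ¬ G.Adj v w := by
    intro v w hv hw h
    have hv' := two v hv
    have hw' := two w hw
    have h1 := htri v w x h
    have h2 := htri v w y h
    have h3 := htri v w z h
    grind [G.adj_comm]
  have := hst.exists_adj (a := a) (b := b) (c := c) (d := d)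
  simp only [List.mem_cons, List.not_mem_nil, or_false, not_or] at *
  grind

/-- Without a 5-cycle, `p`, `q`, `h` are independent, so each remaining vertex sees at least two of
them. Further 5-cycles are avoided only if the remaining vertices are non-adjacent to `u`, `v` and
each other; two of them with `u`, `v` span at most `uv`. -/
theorem IsSTGraph.hasCycleList_five_of_adj_opposite [Finite V] (hst : G.IsSTGraph 4 2)
    (hn : 7 ≤ Nat.card V) {u p v q h : V} (hup : G.Adj u p) (hpv : G.Adj p v) (hvq : G.Adj v q)
    (hqu : G.Adj q u) (hhu : G.Adj h u) (hhv : G.Adj h v) (huv : u ≠ v) (hpq : p ≠ q)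
    (hhp : h ≠ p) (hhq : h ≠ q) : G.HasCycleList 5 := by
  by_contra hno
  have no5 : ∀ a b c d e, G.Adj a b → G.Adj b c → G.Adj c d → G.Adj d e → a ≠ c → a ≠ d →
      b ≠ d → b ≠ e → c ≠ e → ¬ G.Adj e a := fun a b c d e h1 h2 h3 h4 _ _ _ _ _ h5 =>
    hno (hasCycleList_five h1 h2 h3 h4 h5 (by simp [h1.ne, h2.ne, h3.ne, h4.ne, h5.ne', *]))
  have hu : ∀ s, s = p ∨ s = q ∨ s = h → G.Adj u s ∧ G.Adj v s ∧ G.Adj s u ∧ G.Adj s v := by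
    rintro s (rfl | rfl | rfl)
    exacts [⟨hup, hpv.symm, hup.symm, hpv⟩, ⟨hqu.symm, hvq, hqu, hvq.symm⟩,
      ⟨hhu.symm, hhv.symm, hhu, hhv⟩]
  have out : ∀ w, w ∉ [u, p, v, q, h] → ∀ t, t = p ∨ t = q ∨ t = h → w ≠ t := by
    rintro w hw t (rfl | rfl | rfl) rfl <;> simp at hw
  -- the three common neighbours of `u` and `v` are independent
  have ind : ∀ r s t, r = p ∨ r = q ∨ r = h → s = p ∨ s = q ∨ s = h → t = p ∨ t = q ∨ t = h →
      r ≠ s → s ≠ t → r ≠ t → ¬ G.Adj r s := by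
    intro r s t hr hs ht h1 h2 h3 hrs
    exact no5 r s u t v hrs (hu s hs).2.2.1 (hu t ht).1 (hu t ht).2.2.2 (hu r hr).1.ne'
      h3 h2 (hu s hs).2.1.ne' huv (hu r hr).2.1
  have npq := ind p q h (by simp) (by simp) (by simp) hpq hhq.symm hhp.symm
  have nqh := ind q h p (by simp) (by simp) (by simp) hhq.symm hhp hpq.symm
  have nhp := ind h p q (by simp) (by simp) (by simp) hhp hpq hhq
  obtain ⟨x, hx⟩ := exists_notMem_of_length_lt_card [u, p, v, q, h] (by simp; omega)
  obtain ⟨y, hy⟩ := exists_notMem_of_length_lt_card [x, u, p, v, q, h] (by simp; omega)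
  have two : ∀ w, w ∉ [u, p, v, q, h] →
      (G.Adj w p ∨ G.Adj w q) ∧ (G.Adj w q ∨ G.Adj w h) ∧ (G.Adj w h ∨ G.Adj w p) := by
    intro w hw
    have h1 := hst.exists_adj (a := h) (b := w) (c := p) (d := q)
    have h2 := hst.exists_adj (a := p) (b := w) (c := q) (d := h)
    have h3 := hst.exists_adj (a := q) (b := w) (c := h) (d := p)
    simp only [List.mem_cons, List.not_mem_nil, or_false, not_or] at hw
    clear no5 ind hu out
    grind [G.adj_comm]
  have pair : ∀ w, w ∉ [u, p, v, q, h] → ∃ r s, (r = p ∨ r = q ∨ r = h) ∧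
      (s = p ∨ s = q ∨ s = h) ∧ r ≠ s ∧ G.Adj w r ∧ G.Adj w s := by
    intro w hw
    obtain ⟨h1, h2, h3⟩ := two w hw
    by_cases hwp : G.Adj w p
    · by_cases hwq : G.Adj w q
      · exact ⟨p, q, by simp, by simp, hpq, hwp, hwq⟩
      · exact ⟨p, h, by simp, by simp, hhp.symm, hwp, h2.resolve_left hwq⟩
    · exact ⟨q, h, by simp, by simp, hhq.symm, h1.resolve_left hwp, h3.resolve_right hwp⟩
  have nuv : ∀ w, w ∉ [u, p, v, q, h] → ¬ G.Adj w u ∧ ¬ G.Adj w v := by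
    intro w hw
    obtain ⟨r, s, hr, hs, hrs, hwr, hws⟩ := pair w hw
    simp only [List.mem_cons, List.not_mem_nil, or_false, not_or] at hw
    refine ⟨fun hwu => ?_, fun hwv => ?_⟩
    · exact no5 w r v s u hwr (hu r hr).2.2.2 (hu s hs).2.1 (hu s hs).2.2.1 hw.2.2.1 hws.ne hrs
        (hu r hr).1.ne' huv.symm hwu.symm
    · exact no5 w r u s v hwr (hu r hr).2.2.1 (hu s hs).1 (hu s hs).2.2.2 hw.1 hws.ne hrs
        (hu r hr).2.1.ne' huv hwv.symm
  have hy' : y ∉ [u, p, v, q, h] := fun h => hy (List.mem_cons_of_mem _ h)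
  have hyx : y ≠ x := fun h => hy (by simp [h])
  have nxy : ¬ G.Adj x y := by
    intro hxy
    obtain ⟨r, s, hr, hs, hrs, hwr, hws⟩ := pair x hx
    obtain ⟨r', s', hr', hs', hrs', hwr', hws'⟩ := pair y hy'
    obtain ⟨t, ht, htr, hyt⟩ : ∃ t, (t = p ∨ t = q ∨ t = h) ∧ r ≠ t ∧ G.Adj y t := by
      by_cases hrr : r = r'
      · exact ⟨s', hs', hrr ▸ hrs', hws'⟩
      · exact ⟨r', hr', hrr, hwr'⟩
    have hxu : x ≠ u := fun h => hx (by simp [h])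
    have hyu : u ≠ y := fun h => hy' (by simp [h])
    exact no5 x r u t y hwr (hu r hr).2.2.1 (hu t ht).1 hyt.symm hxu (out x hx t ht) htr
      (out y hy' r hr).symm hyu hxy.symm
  have := hst.exists_adj (a := u) (b := v) (c := x) (d := y)
  have n1 := nuv x hx
  have n2 := nuv y hy'
  simp only [List.mem_cons, List.not_mem_nil, or_false, not_or] at hx hy'
  clear no5 ind hu out two pair nuv
  grind [G.adj_comm]

/-- If some vertex outside a cycle has two neighbours on it, then the cycle length can be
increased by one. -/
theorem IsSTGraph.hasCycleList_succ_of_adj_adj [Finite V] (hst : G.IsSTGraph 4 2)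
    (hn : 7 ≤ Nat.card V) {a h : V} {l : List V} (hC : G.IsCycleList a l) (hh : h ∉ a :: l)
    {x y : V} (hx : x ∈ a :: l) (hy : y ∈ a :: l) (hxy : x ≠ y) (hhx : G.Adj h x)
    (hhy : G.Adj h y) : G.HasCycleList ((a :: l).length + 1) := by
  by_cases hlen : (a :: l).length = 4
  · obtain ⟨m, hm, hperm⟩ := hC.exists_rotate hx
    rw [hlen]
    rw [← hperm.length_eq] at hlen
    rw [← hperm.mem_iff] at hh hy
    match m, hlen with
    | [b, c, d], _ =>
      obtain ⟨hnd, hch⟩ := hm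
      simp only [List.nodup_cons, List.mem_cons, List.not_mem_nil, or_false, not_or] at hnd hh hy
      simp only [List.cons_append, List.nil_append, List.isChain_cons_cons, List.IsChain.singleton,
        and_true] at hch
      obtain ⟨h1, h2, h3, h4⟩ := hch
      rcases hy with rfl | rfl | rfl | rfl
      · exact absurd rfl hxy
      · exact hasCycleList_five hhx.symm hhy h2 h3 h4 (by simp; grind)
      · exact hst.hasCycleList_five_of_adj_opposite hn h1 h2 h3 h4 hhx hhy hxy hnd.2.1.2 hh.2.1
          hh.2.2.2
      · exact hasCycleList_five hhx h1 h2 h3 hhy.symm (by simp; grind)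
  · exact hasCycleList_of_adj_adj hst hC hlen hh hx hy hxy hhx hhy

/-- Without a 4-cycle, an outside vertex misses at most one of any three other outside vertices, so
four outside vertices carry a 4-cycle after all. -/
theorem IsSTGraph.hasCycleList_four_of_triangle [Finite V] (hst : G.IsSTGraph 4 2)
    (hn : 7 ≤ Nat.card V) {x y z : V} (hxy : G.Adj x y) (hyz : G.Adj y z) (hzx : G.Adj z x)
    (hB : ∀ h, h ∉ [x, y, z] → ∀ u ∈ [x, y, z], ∀ v ∈ [x, y, z], G.Adj h u → G.Adj h v → u = v) :
    G.HasCycleList 4 := by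
  by_contra hno
  have no4 : ∀ a b c d, a ≠ c → b ≠ d → G.Adj a b → G.Adj b c → G.Adj c d → ¬ G.Adj d a :=
    fun a b c d hac hbd h1 h2 h3 h4 => hno (hasCycleList_four h1 h2 h3 h4 hac hbd)
  obtain ⟨a, ha⟩ := exists_notMem_of_length_lt_card [x, y, z] (by simp; omega)
  obtain ⟨b, hb⟩ := exists_notMem_of_length_lt_card [a, x, y, z] (by simp; omega)
  obtain ⟨c, hc⟩ := exists_notMem_of_length_lt_card [b, a, x, y, z] (by simp; omega)
  obtain ⟨d, hd⟩ := exists_notMem_of_length_lt_card [c, b, a, x, y, z] (by simp; omega)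
  have one : ∀ h, h ∉ [x, y, z] → ¬ (G.Adj h x ∧ G.Adj h y) ∧ ¬ (G.Adj h y ∧ G.Adj h z) ∧
      ¬ (G.Adj h z ∧ G.Adj h x) := by
    intro h hh
    have := hB h hh
    refine ⟨fun H => hxy.ne ?_, fun H => hyz.ne ?_, fun H => hzx.ne ?_⟩ <;>
      exact this _ (by simp) _ (by simp) H.1 H.2
  -- nonadjacent outside vertices have distinct neighbours on the triangle
  have non : ∀ p q, p ∉ [x, y, z] → q ∉ [x, y, z] → p ≠ q → ¬ G.Adj p q →
      (G.Adj p x ∨ G.Adj p y ∨ G.Adj q x ∨ G.Adj q y) ∧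
      (G.Adj p y ∨ G.Adj p z ∨ G.Adj q y ∨ G.Adj q z) ∧
      (G.Adj p z ∨ G.Adj p x ∨ G.Adj q z ∨ G.Adj q x) := by
    intro p q hp hq hpq hn
    have h1 := hst.exists_adj (a := x) (b := y) (c := p) (d := q)
    have h2 := hst.exists_adj (a := y) (b := z) (c := p) (d := q)
    have h3 := hst.exists_adj (a := z) (b := x) (c := p) (d := q)
    have := hxy.ne
    have := hyz.ne
    have := hzx.ne
    simp only [List.mem_cons, List.not_mem_nil, or_false, not_or] at hp hq
    clear no4 one hB
    grind [G.adj_comm]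
  have diff : ∀ p q, p ∉ [x, y, z] → q ∉ [x, y, z] → ∀ u ∈ [x, y, z], ∀ v ∈ [x, y, z],
      u ≠ v → G.Adj p u → G.Adj q v → ¬ G.Adj p q := by
    intro p q hp hq u hu v hv huv hpu hqv hpq
    have huv' : G.Adj u v := by
      simp only [List.mem_cons, List.not_mem_nil, or_false] at hu hv
      clear no4 one non hB
      grind [G.adj_comm]
    exact no4 p u v q (fun h => hp (h ▸ hv)) (fun h => hq (h ▸ hu)) hpu huv' hqv.symm hpq.symm
  -- If `p` misses `q` and `r`, each has exactly one neighbour on the triangle, that of `p`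
  -- differing from the other two. If those of `q` and `r` coincide, the third corner with `p`, `q`,
  -- `r` spans at most `qr`; otherwise `q`, `r` are non-adjacent and `p`, `q`, `r` with `x` span one
  -- edge.
  have triple : ∀ p q r, p ∉ [x, y, z] → q ∉ [x, y, z] → r ∉ [x, y, z] → p ≠ q → q ≠ r → p ≠ r →
      G.Adj p q ∨ G.Adj p r := by
    intro p q r hp hq hr hpq hqr hpr
    by_contra! hcon
    have op := one p hp
    have oq := one q hq
    have or' := one r hr
    have n1 := non p q hp hq hpq hcon.1
    have n2 := non p r hp hr hpr hcon.2
    have d1 := diff q r hq hr x (by simp) y (by simp) hxy.ne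
    have d2 := diff q r hq hr y (by simp) x (by simp) hxy.ne'
    have d3 := diff q r hq hr y (by simp) z (by simp) hyz.ne
    have d4 := diff q r hq hr z (by simp) y (by simp) hyz.ne'
    have d5 := diff q r hq hr z (by simp) x (by simp) hzx.ne
    have d6 := diff q r hq hr x (by simp) z (by simp) hzx.ne'
    have t1 := hst.exists_adj (a := q) (b := r) (c := p) (d := x)
    have t2 := hst.exists_adj (a := q) (b := r) (c := p) (d := y)
    have t3 := hst.exists_adj (a := q) (b := r) (c := p) (d := z)
    have t4 := hst.exists_adj (a := p) (b := x) (c := q) (d := r)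
    have t5 := hst.exists_adj (a := q) (b := x) (c := p) (d := r)
    have t6 := hst.exists_adj (a := r) (b := x) (c := p) (d := q)
    simp only [List.mem_cons, List.not_mem_nil, or_false, not_or] at hp hq hr
    have := G.adj_comm p q
    have := G.adj_comm p r
    have := G.adj_comm q r
    have := G.adj_comm x p
    have := G.adj_comm x q
    have := G.adj_comm x r
    clear no4 one non diff hB
    grind
  have h1 := triple a b c
  have h2 := triple a c d
  have h3 := triple a b d
  have h4 := triple b a c
  have h5 := triple b c d
  have h6 := triple b a d
  have h7 := triple c a b
  have h8 := triple c b d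
  have h9 := triple c a d
  have h10 := triple d a b
  have h11 := triple d b c
  have h12 := triple d a c
  -- The three possible 4-cycles on `a`, `b`, `c`, `d`.
  have m1 := no4 a b c d
  have m2 := no4 a c b d
  have m3 := no4 a b d c
  simp only [List.mem_cons, List.not_mem_nil, or_false, not_or] at *
  have := G.adj_comm a b
  have := G.adj_comm a c
  have := G.adj_comm a d
  have := G.adj_comm b c
  have := G.adj_comm b d
  have := G.adj_comm c d
  clear no4 one non diff hB triple
  grind

/-! ### Outside vertices with at most one neighbour on the cycle -/

theorem _root_.List.Nodup.exists_mem_notMem_of_length_lt {α : Type*} {l m : List α}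
    (hl : l.Nodup) (h : m.length < l.length) : ∃ z ∈ l, z ∉ m := by
  by_contra! hcon
  exact absurd (List.subperm_of_subset hl hcon).length_le h.not_ge

/-- Let `C` be a list of vertices that form a clique up to `u₁` and `u₂`, which in turn have distinct
neighbours in the clique. If an edge `h₁h₂` outside `C` is joined to `u₁` and `u₂` by disjoint edges,
then there is a cycle of length `C.length + 1`. -/
theorem hasCycleList_succ_of_isClique {C : List V} (hnd : C.Nodup) {h₁ h₂ u₁ u₂ a b : V}
    (hlen : 5 ≤ C.length) (hh : G.Adj h₁ h₂) (hh₁ : h₁ ∉ C) (hh₂ : h₂ ∉ C) (hu₁ : u₁ ∈ C)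
    (hu₂ : u₂ ∈ C) (hu : u₁ ≠ u₂) (hhu₁ : G.Adj h₁ u₁) (hhu₂ : G.Adj h₂ u₂)
    (hW : ∀ w ∈ C, ∀ w' ∈ C, w ≠ w' → w ≠ u₁ → w ≠ u₂ → w' ≠ u₁ → w' ≠ u₂ → G.Adj w w')
    (haC : a ∈ C) (hbC : b ∈ C) (hab : a ≠ b) (hau₂ : a ≠ u₂) (hbu₁ : b ≠ u₁)
    (hua : G.Adj u₁ a) (hub : G.Adj u₂ b) : G.HasCycleList (C.length + 1) := by
  classical
  -- The new cycle is `h₂ h₁ u₁ a M b u₂`: six fixed vertices, so `M` supplies `C.length - 5` and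
  -- one vertex of `C` is dropped.
  obtain ⟨S, hS, hSc⟩ : ∃ S ⊆ C.toFinset \ {u₁, u₂, a, b}, S.card = C.length - 5 := by
    apply Finset.exists_subset_card_eq
    have h1 := Finset.le_card_sdiff {u₁, u₂, a, b} C.toFinset
    have h2 := Finset.card_le_four (a := u₁) (b := u₂) (c := a) (d := b)
    rw [List.toFinset_card_of_nodup hnd] at h1
    omega
  have hM : ∀ z ∈ S.toList, z ∈ C ∧ z ≠ u₁ ∧ z ≠ u₂ ∧ z ≠ a ∧ z ≠ b := by
    intro z hz
    have := hS (Finset.mem_toList.mp hz)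
    simpa [and_assoc] using this
  have hMnd := S.nodup_toList
  have hMl : S.toList.length = C.length - 5 := by simpa using hSc
  generalize S.toList = M at hM hMnd hMl
  have hnotM : ∀ z, (z ∉ C ∨ z = u₁ ∨ z = u₂ ∨ z = a ∨ z = b) → z ∉ M := by
    intro z hz hzM
    have := hM z hzM
    tauto
  have hPnd : (a :: (M ++ [b])).Nodup := by
    have h1 := hnotM a (by simp)
    have h2 := hnotM b (by simp)
    grind
  have hP : (a :: (M ++ [b])).IsChain G.Adj := by
    refine (hPnd.pairwise_of_forall_ne ?_).isChain
    have hmem : ∀ z ∈ a :: (M ++ [b]), z ∈ C ∧ z ≠ u₁ ∧ z ≠ u₂ := by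
      intro z hz
      simp only [List.mem_cons, List.mem_append, List.not_mem_nil, or_false] at hz
      rcases hz with rfl | hz | rfl
      · exact ⟨haC, hua.ne', hau₂⟩
      · exact ⟨(hM z hz).1, (hM z hz).2.1, (hM z hz).2.2.1⟩
      · exact ⟨hbC, hbu₁, hub.ne'⟩
    intro s hs t ht hst
    have h1 := hmem s hs
    have h2 := hmem t ht
    exact hW s h1.1 t h2.1 hst h1.2.1 h1.2.2 h2.2.1 h2.2.2
  refine ⟨h₂, h₁ :: u₁ :: a :: (M ++ [b, u₂]), ⟨?_, ?_⟩, ?_⟩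
  · have k1 := hnotM h₁ (by simp [hh₁])
    have k2 := hnotM h₂ (by simp [hh₂])
    have k3 := hnotM u₁ (by simp)
    have k4 := hnotM u₂ (by simp)
    have n1 : ∀ z ∈ C, h₁ ≠ z := fun z hz h => hh₁ (h ▸ hz)
    have n2 : ∀ z ∈ C, h₂ ≠ z := fun z hz h => hh₂ (h ▸ hz)
    have := n1 _ hu₁
    have := n1 _ hu₂
    have := n1 _ haC
    have := n1 _ hbC
    have := n2 _ hu₁
    have := n2 _ hu₂
    have := n2 _ haC
    have := n2 _ hbC
    have := hh.ne
    have := hua.ne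
    have := hub.ne
    clear n1 n2 hM hnotM hW hP
    have h1 : u₁ ∉ a :: (M ++ [b, u₂]) := by simp [*, hbu₁.symm]
    have h2 : h₁ ∉ u₁ :: a :: (M ++ [b, u₂]) := by simp [*]
    have h3 : h₂ ∉ h₁ :: u₁ :: a :: (M ++ [b, u₂]) := by simp [*, hh.ne']
    have h4 : (a :: (M ++ [b, u₂])).Nodup := by
      have : a :: (M ++ [b, u₂]) = (a :: (M ++ [b])) ++ [u₂] := by simp
      rw [this, List.nodup_append]
      refine ⟨hPnd, by simp, ?_⟩
      rintro s hs t ht rfl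
      simp only [List.mem_cons, List.not_mem_nil, or_false] at ht
      subst ht
      simp only [List.mem_cons, List.mem_append, List.not_mem_nil, or_false] at hs
      grind
    exact .cons h3 (.cons h2 (.cons h1 h4))
  · have e : h₂ :: (h₁ :: u₁ :: a :: (M ++ [b, u₂]) ++ [h₂]) =
      h₂ :: h₁ :: u₁ :: ((a :: M) ++ b :: [u₂, h₂]) := by simp
    rw [e]
    refine .cons_cons hh.symm (.cons_cons hhu₁ ?_)
    rw [← List.cons_append, List.isChain_split]
    exact ⟨.cons_cons hua hP, by simp [hub.symm, hhu₂.symm]⟩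
  · simp only [List.length_cons, List.length_append, List.length_nil, hMl]
    omega

/-- The cycle length can be increased by one if every outside vertex has at most one neighbour on
the cycle. -/
theorem IsSTGraph.hasCycleList_succ_of_unique_adj [Finite V] (hst : G.IsSTGraph 4 2)
    (hconn : G.IsKVertexConnected 2) (hn : 7 ≤ Nat.card V) {a : V} {l : List V}
    (hC : G.IsCycleList a l) (h3 : 3 ≤ (a :: l).length) (hlt : (a :: l).length < Nat.card V)
    (hB : ∀ h, h ∉ a :: l → ∀ u ∈ a :: l, ∀ v ∈ a :: l, G.Adj h u → G.Adj h v → u = v) :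
    G.HasCycleList ((a :: l).length + 1) := by
  classical
  rcases h3.eq_or_lt with h3 | h4
  · rw [← h3]
    match l, h3 with
    | [b, c], _ =>
      have hch := hC.2
      simp only [List.cons_append, List.nil_append, List.isChain_cons_cons, List.IsChain.singleton,
        and_true] at hch
      exact hst.hasCycleList_four_of_triangle hn hch.1 hch.2.1 hch.2.2 hB
  obtain ⟨h₀, hh₀⟩ := exists_notMem_of_length_lt_card _ hlt
  have edge : ∀ u ∈ a :: l, ∃ v h, G.Adj v h ∧ v ∈ a :: l ∧ v ≠ u ∧ h ∉ a :: l := by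
    intro u hu
    obtain ⟨v, hv, hvu⟩ := hC.1.exists_mem_notMem_of_length_lt (m := [u]) (by simp; grind)
    obtain ⟨s, t, h1, h2, h3, h4, -⟩ := exists_adj_of_connected_induce_compl
      (hconn.2 {u} (by simp)) {z | z ∈ a :: l} hv (by simpa using hvu) hh₀
      (by simp only [Finset.mem_singleton]; rintro rfl; exact hh₀ hu)
    exact ⟨s, t, h1, h2, by simpa using h3, h4⟩
  -- Avoiding `a` is irrelevant here; the second edge has to avoid `u₁`.
  obtain ⟨u₁, h₁, hhu₁, hu₁, -, hh₁⟩ := edge a (by simp)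
  obtain ⟨u₂, h₂, hhu₂, hu₂, hne, hh₂⟩ := edge u₁ hu₁
  clear edge
  have hhne : h₁ ≠ h₂ := by
    rintro rfl
    exact hne (hB h₁ hh₁ u₂ hu₂ u₁ hu₁ hhu₂.symm hhu₁.symm)
  have attach : ∀ h, h ∉ a :: l → ∃ u, ∀ c ∈ a :: l, G.Adj h c → c = u := by
    intro h hh
    by_cases H : ∃ u ∈ a :: l, G.Adj h u
    · obtain ⟨u, hu, hhu⟩ := H
      exact ⟨u, fun c hc hhc => hB h hh c hc u hu hhc hhu⟩
    · push Not at H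
      -- `a` is a dummy: `h` has no neighbour on the cycle.
      exact ⟨a, fun c hc hhc => absurd hhc (H c hc)⟩
  have out : ∀ h h', h ∉ a :: l → h' ∉ a :: l → h ≠ h' → G.Adj h h' := by
    intro h h' hh hh' hne
    obtain ⟨u, hu⟩ := attach h hh
    obtain ⟨u', hu'⟩ := attach h' hh'
    -- Two cycle vertices that neither `h` nor `h'` sees: with `h`, `h'` they span a second edge
    -- only if it is `hh'`.
    obtain ⟨w, hw, hwn⟩ := hC.1.exists_mem_notMem_of_length_lt (m := [u, u']) (by simp; grind)
    obtain ⟨w', hw', hwn'⟩ := hC.1.exists_mem_notMem_of_length_lt (m := [w, u, u']) (by simp; grind)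
    have adj := hst.exists_adj (a := w) (b := w') (c := h) (d := h')
    have k1 := hu w hw
    have k2 := hu w' hw'
    have k3 := hu' w hw
    have k4 := hu' w' hw'
    have m1 : w ≠ h := fun e => hh (e ▸ hw)
    have m2 : w ≠ h' := fun e => hh' (e ▸ hw)
    have m3 : w' ≠ h := fun e => hh (e ▸ hw')
    have m4 : w' ≠ h' := fun e => hh' (e ▸ hw')
    simp only [G.adj_comm _ h] at adj k1 k2
    simp only [G.adj_comm w h', G.adj_comm w' h'] at adj
    simp only [List.mem_cons, List.not_mem_nil, or_false, not_or] at hwn hwn'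
    rcases adj (Ne.symm hwn'.1) m1 m2 m3 m4 hne with H | H | H | H | H
    exacts [absurd (k1 H) hwn.1, absurd (k3 H) hwn.2, absurd (k2 H) hwn'.2.1,
      absurd (k4 H) hwn'.2.2, H]
  have hW : ∀ w ∈ a :: l, ∀ w' ∈ a :: l, w ≠ w' → w ≠ u₁ → w ≠ u₂ → w' ≠ u₁ → w' ≠ u₂ →
      G.Adj w w' := by
    intro w hw w' hw' hww h1 h2 h3 h4
    have := hst.exists_adj (a := h₁) (b := h₂) (c := w) (d := w')
    have k1 := fun h => h1 (hB h₁ hh₁ w hw u₁ hu₁ h hhu₁.symm)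
    have k2 := fun h => h2 (hB h₂ hh₂ w hw u₂ hu₂ h hhu₂.symm)
    have k3 := fun h => h3 (hB h₁ hh₁ w' hw' u₁ hu₁ h hhu₁.symm)
    have k4 := fun h => h4 (hB h₂ hh₂ w' hw' u₂ hu₂ h hhu₂.symm)
    have m1 : h₁ ≠ w := fun h => hh₁ (h ▸ hw)
    have m2 : h₁ ≠ w' := fun h => hh₁ (h ▸ hw')
    have m3 : h₂ ≠ w := fun h => hh₂ (h ▸ hw)
    have m4 : h₂ ≠ w' := fun h => hh₂ (h ▸ hw')
    tauto
  have hh := out h₁ h₂ hh₁ hh₂ hhne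
  have hu₁₂ : ¬ G.Adj h₂ u₁ := fun h => hne (hB h₂ hh₂ u₂ hu₂ u₁ hu₁ hhu₂.symm h)
  have hu₂₁ : ¬ G.Adj h₁ u₂ := fun h => hne (hB h₁ hh₁ u₂ hu₂ u₁ hu₁ h hhu₁.symm)
  rcases (Nat.succ_le_of_lt h4).eq_or_lt with h4 | h5
  · obtain ⟨m, hm, hperm⟩ := hC.exists_rotate hu₁
    rw [← h4]
    -- Length 4: if `u₁`, `u₂` are consecutive, the 5-cycle needs a third outside vertex, available
    -- as `n ≥ 7`; if opposite, it passes through a cycle vertex between them.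
    have h₃ := exists_notMem_of_length_lt_card (h₁ :: h₂ :: a :: l) (by simp at h4 ⊢; omega)
    obtain ⟨h₃, hh₃⟩ := h₃
    simp only [List.mem_cons (a := h₃) (l := h₂ :: a :: l), List.mem_cons (a := h₃) (l := a :: l),
      not_or (q := h₃ ∈ a :: l), not_or (p := h₃ = h₁)] at hh₃
    have e1 := out h₁ h₃ hh₁ hh₃.2.2 (Ne.symm hh₃.1)
    have e2 := out h₃ h₂ hh₃.2.2 hh₂ hh₃.2.1
    have nh : ∀ h, h ∉ a :: l → ∀ z ∈ a :: l, h ≠ z := fun h hh z hz e => hh (e ▸ hz)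
    have five : G.Adj u₂ u₁ → G.HasCycleList 5 := fun e =>
      hasCycleList_five e1 e2 hhu₂.symm e hhu₁ (by
        simp [hhne, e1.ne, e2.ne, hhu₂.ne', e.ne, nh h₁ hh₁ _ hu₁, nh h₁ hh₁ _ hu₂,
          nh h₃ hh₃.2.2 _ hu₁, nh h₃ hh₃.2.2 _ hu₂, nh h₂ hh₂ _ hu₁])
    have hml : (u₁ :: m).length = 4 := by rw [hperm.length_eq]; exact h4.symm
    rw [← hperm.mem_iff] at hu₂
    match m, hml with
    | [b, c, d], _ =>
      have hbC : b ∈ a :: l := hperm.mem_iff.mp (by simp)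
      obtain ⟨hnd, hch⟩ := hm
      simp only [List.nodup_cons, List.mem_cons, List.not_mem_nil, or_false, not_or] at hnd hu₂
      simp only [List.cons_append, List.nil_append, List.isChain_cons_cons, List.IsChain.singleton,
        and_true] at hch
      rcases hu₂ with rfl | rfl | rfl | rfl
      · exact absurd rfl hne
      · exact five hch.1.symm
      · have hu₂C : u₂ ∈ a :: l := hperm.mem_iff.mp (by simp)
        exact hasCycleList_five hhu₁.symm hch.1 hch.2.1 hhu₂ hh.symm (by
          simp [hhne, nh h₁ hh₁ _ hu₁, nh h₁ hh₁ _ hu₂C, nh h₁ hh₁ _ hbC, (nh h₂ hh₂ _ hu₁).symm,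
            (nh h₂ hh₂ _ hbC).symm, hch.1.ne, hch.2.1.ne, hne.symm, hhu₂.ne])
      · exact five hch.2.2.2
  -- Each of `u₁`, `u₂` misses at most one vertex of the clique, so three clique vertices suffice to
  -- find distinct neighbours `s`, `t`.
  · have link : ∀ u ∈ a :: l, ∀ h, h ∉ a :: l → ¬ G.Adj h u →
        (∀ w ∈ a :: l, w ≠ u₁ → w ≠ u₂ → ¬ G.Adj h w) → (u = u₁ ∨ u = u₂) → ∀ w ∈ a :: l,
        ∀ w' ∈ a :: l, w ≠ w' → w ≠ u₁ → w ≠ u₂ → w' ≠ u₁ → w' ≠ u₂ → G.Adj u w ∨ G.Adj u w' := by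
      intro u hu h hh hhu hhw huu w hw w' hw' hww k1 k2 k3 k4
      have := hst.exists_adj (a := w) (b := w') (c := u) (d := h)
      have m1 : w ≠ h := fun e => hh (e ▸ hw)
      have m2 : w' ≠ h := fun e => hh (e ▸ hw')
      have m3 : u ≠ h := fun e => hh (e ▸ hu)
      have m4 : w ≠ u := by rintro rfl; tauto
      have m5 : w' ≠ u := by rintro rfl; tauto
      have m6 := hhw w hw k1 k2
      have m7 := hhw w' hw' k3 k4
      have := this hww m4 m1 m5 m2 m3
      simp only [G.adj_comm _ h] at this
      simp only [G.adj_comm w u, G.adj_comm w' u] at this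
      tauto
    have link₁ := link u₁ hu₁ h₂ hh₂ hu₁₂
      (fun w hw _ k h => k (hB h₂ hh₂ w hw u₂ hu₂ h hhu₂.symm)) (.inl rfl)
    have link₂ := link u₂ hu₂ h₁ hh₁ hu₂₁
      (fun w hw k _ h => k (hB h₁ hh₁ w hw u₁ hu₁ h hhu₁.symm)) (.inr rfl)
    clear link
    obtain ⟨x, hx, hxn⟩ := hC.1.exists_mem_notMem_of_length_lt (m := [u₁, u₂]) (by simp; grind)
    obtain ⟨y, hy, hyn⟩ := hC.1.exists_mem_notMem_of_length_lt (m := [x, u₁, u₂]) (by simp; grind)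
    obtain ⟨z, hz, hzn⟩ := hC.1.exists_mem_notMem_of_length_lt (m := [y, x, u₁, u₂])
      (by simp; grind)
    obtain ⟨s, t, hs, ht, hst', hs2, ht1, hus, hut⟩ : ∃ s t, s ∈ a :: l ∧ t ∈ a :: l ∧ s ≠ t ∧
        s ≠ u₂ ∧ t ≠ u₁ ∧ G.Adj u₁ s ∧ G.Adj u₂ t := by
      have a1 := link₁ x hx y hy
      have a2 := link₁ y hy z hz
      have a3 := link₁ x hx z hz
      have b1 := link₂ x hx y hy
      have b2 := link₂ y hy z hz
      have b3 := link₂ x hx z hz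
      simp only [List.mem_cons (b := u₁), List.mem_cons (b := u₂), List.mem_cons (b := x),
        List.mem_cons (b := y), List.not_mem_nil, or_false, not_or] at hxn hyn hzn
      clear link₁ link₂ hW out attach hB
      generalize a :: l = C at *
      grind
    exact hasCycleList_succ_of_isClique hC.1 h5 hh hh₁ hh₂ hu₁ hu₂ hne.symm hhu₁.symm hhu₂.symm hW
      hs ht hst' hs2 ht1 hus hut

end SimpleGraph

theorem theorem6 {V : Type*} [Finite V] (G : SimpleGraph V)
    (hn : 7 ≤ Nat.card V) (hconn : G.IsKVertexConnected 2) (hst : G.IsSTGraph 4 2) :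
    G.IsPancyclic := by
  have main : ∀ k, 3 ≤ k → k ≤ Nat.card V → G.HasCycleList k := by
    intro k hk
    induction k, hk using Nat.le_induction with
    | base => exact fun _ => hst.hasCycleList_three hn
    | succ k hk ih =>
      intro hlt
      obtain ⟨a, l, hC, rfl⟩ := ih (by omega)
      by_cases hB : ∀ h, h ∉ a :: l → ∀ u ∈ a :: l, ∀ v ∈ a :: l, G.Adj h u → G.Adj h v → u = v
      · exact hst.hasCycleList_succ_of_unique_adj hconn hn hC hk hlt hB
      · push Not at hB
        obtain ⟨h, hh, u, hu, v, hv, hhu, hhv, huv⟩ := hB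
        exact hst.hasCycleList_succ_of_adj_adj hn hC hh hu hv huv hhu hhv
  exact fun k hk hkn => (main k hk hkn).hasCycleOfLength hk
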